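/- **Theorem 1.1.** Identify $\mathbb{R}^4$ with $\mathbb{C}^2$ by $(x_1,x_2,y_1,y_2)\mapsto(x_1+iy_1,x_2+iy_2)$, with the Euclidean inner product $\langle\cdot,\cdot\rangle$, the complex structure $J(x_1,x_2,y_1,y_2)=(-y_1,-y_2,x_1,x_2)$ and the symplectic form $\omega_0=dx_1\wedge dy_1+dx_2\wedge dy_2$. Let $D=\{x\in\mathbb{R}^2: |x|\le 1\}$, let $\mathbb{B}^4$ be the closed unit ball of $\mathbb{R}^4$ and $\mathbb{S}^3=\partial\mathbb{B}^4$. Let $\iota:D\to\mathbb{B}^4$ be a map of class $C^2$ up to the boundary that is an immersion except at finitely many points of $D$ (the branch points, which may lie in the interior or on $\partial D$; there may be none), with $\iota(\partial D)\subset\mathbb{S}^3$. Assume that 1. $\iota$ is minimal: its mean curvature vector vanishes at every point where $\iota$ is an immersion; 2. $\iota$ is Lagrangian: $\iota^*\omega_0=0$; 3. the boundary is Legendrian in $\mathbb{S}^3$: $\langle J\iota(x),d\iota_x(w)\rangle=0$ for all $x\in\partial D$ and all $w\in T_x\partial D$; 4. the contact angle is constant: there is a $\theta\in\mathbb{R}$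 such that, at every $x\in\partial D$ where $\iota$ is an immersion, the outward unit conormal $\mu$ of the surface along its boundary is $\mu=\sin\theta\,\iota(x)+\cos\theta\,J\iota(x)$. Then $\iota(D)$ is an equatorial plane disk: there is a two-dimensional linear subspace $P\subset\mathbb{R}^4$ such that $\iota(D)=P\cap\mathbb{B}^4$. -/

import Mathlib

open scoped InnerProductSpace

noncomputable section

namespace CapillaryLagrangian

/-- The Euclidean plane. -/
abbrev R2 : Type := EuclideanSpace ℝ (Fin 2)

/-- Euclidean four-space with coordinates `(x₁, x₂, y₁, y₂)`, identified with `ℂ²` through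
`(x₁ + i y₁, x₂ + i y₂)`. -/
abbrev R4 : Type := EuclideanSpace ℝ (Fin 4)

/-- The closed unit disk `D` of the plane. -/
def disk : Set R2 := Metric.closedBall 0 1

/-- The boundary circle `∂D`. -/
def circle : Set R2 := Metric.sphere 0 1

/-- The standard complex structure `J (x₁, x₂, y₁, y₂) = (-y₁, -y₂, x₁, x₂)`. -/
def J : R4 →ₗ[ℝ] R4 where
  toFun p := !₂[-p 2, -p 3, p 0, p 1]
  map_add' p q := by
    ext i
    fin_cases i <;> simp <;> ring
  map_smul' c p := by
    ext i
    fin_cases i <;> simp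

/-- The standard symplectic form `ω₀ = dx₁ ∧ dy₁ + dx₂ ∧ dy₂`. -/
def omega (u v : R4) : ℝ :=
  (u 0 * v 2 - u 2 * v 0) + (u 1 * v 3 - u 3 * v 1)

/-- The differential of `ι` at a point of the closed disk (one-sided at boundary points). -/
def differential (ι : R2 → R4) (x : R2) : R2 →L[ℝ] R4 :=
  fderivWithin ℝ ι disk x

/-- The second derivative of `ι` at a point of the closed disk. -/
def secondDerivative (ι : R2 → R4) (x : R2) : R2 →L[ℝ] R2 →L[ℝ] R4 :=
  fderivWithin ℝ (fderivWithin ℝ ι disk) disk x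

/-- The points of the closed disk at which `ι` is an immersion. -/
def regularPoints (ι : R2 → R4) : Set R2 :=
  {x ∈ disk | Function.Injective (differential ι x)}

/-- A branched immersion of the closed disk, of class `C²`: the differential is injective
except at finitely many points (on a compact disk: except at isolated points), which may lie in
the interior or on the boundary. An immersion of the closed disk is the case without exceptional
points. Nothing is asked of the parametrization (it need not be conformal) or of the local form of
the map at the exceptional points. -/
structure IsBranchedImmersion (ι : R2 → R4) : Prop where
  contDiffOn : ContDiffOn ℝ 2 ι disk
  finite_branch : (disk \ regularPoints ι).Finite

/-- The tangent plane `dι (T_x D)` of the surface, as a subspace of `ℝ⁴`. -/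
def tangentPlane (ι : R2 → R4) (x : R2) : Submodule ℝ R4 :=
  LinearMap.range (differential ι x).toLinearMap

/-- The second fundamental form `h (v, w)`: the normal component of the second derivative. -/
def secondFundamentalForm (ι : R2 → R4) (x v w : R2) : R4 :=
  (tangentPlane ι x)ᗮ.starProjection (secondDerivative ι x v w)

/-- The surface is minimal: at every point where `ι` is an immersion the mean curvature vector
`H = h (e₁, e₁) + h (e₂, e₂)` vanishes, for `(e₁, e₂)` orthonormal in the induced metric. -/
def IsMinimal (ι : R2 → R4) : Prop :=
  ∀ x ∈ regularPoints ι, ∀ e : Fin 2 → R2,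
    Orthonormal ℝ (fun i => differential ι x (e i)) →
      ∑ i, secondFundamentalForm ι x (e i) (e i) = 0

/-- The surface is Lagrangian: `ι^* ω₀ = 0`. -/
def IsLagrangian (ι : R2 → R4) : Prop :=
  ∀ x ∈ disk, ∀ v w : R2, omega (differential ι x v) (differential ι x w) = 0

/-- The boundary is Legendrian in the unit sphere: the Reeb field `ξ = J N`, with `N` the
position vector, is orthogonal to the image of every tangent vector of `∂D`. -/
def HasLegendrianBoundary (ι : R2 → R4) : Prop :=
  ∀ x ∈ circle, ∀ w : R2, ⟪x, w⟫_ℝ = 0 → ⟪J (ι x), differential ι x w⟫_ℝ = 0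

/-- `μ` is the outward unit conormal of the surface at the boundary parameter `x`: a unit vector,
tangent to the surface, orthogonal to the boundary curve, and the image of a vector pointing out
of the disk. -/
def IsOutwardConormal (ι : R2 → R4) (x : R2) (μ : R4) : Prop :=
  ‖μ‖ = 1 ∧ (∃ v : R2, 0 < ⟪x, v⟫_ℝ ∧ differential ι x v = μ) ∧
    ∀ w : R2, ⟪x, w⟫_ℝ = 0 → ⟪μ, differential ι x w⟫_ℝ = 0

/-- The contact angle with the unit sphere is the constant `θ`: the outward unit conormal is
`μ = sin θ N + cos θ J N` at every boundary point where `ι` is an immersion. -/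
def HasConstantContactAngle (ι : R2 → R4) (θ : ℝ) : Prop :=
  ∀ x ∈ circle, x ∈ regularPoints ι → ∀ μ : R4, IsOutwardConormal ι x μ →
    μ = Real.sin θ • ι x + Real.cos θ • J (ι x)

/-- An equatorial plane disk: the intersection of the closed unit ball with a two-dimensional
linear subspace. -/
def IsEquatorialPlaneDisk (A : Set R4) : Prop :=
  ∃ P : Submodule ℝ R4, Module.finrank ℝ P = 2 ∧ A = (P : Set R4) ∩ Metric.closedBall 0 1

end CapillaryLagrangian

end

/-!
Everything rests on the complex structures of `ℝ⁴ = ℂ²` that anticommute with `J`, and no conformal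
parametrization is needed.

*Constant phase.* On a Lagrangian tangent plane with orthonormal basis `a, b` the complex volume
`dz₁ ∧ dz₂ (a, b)` has modulus one. Its argument, the Lagrangian angle, has derivative
`⟨H, J ·⟩` with `H` the mean curvature vector, by the total symmetry of `⟨h (·, ·), J ·⟩`. So it is
locally constant on a minimal surface, and the disk stays connected when finitely many points are
removed (`exists_phase`). If the phase is `c = p + i q`, then the antilinear map
`K = quat p q : z ↦ c j(z)`, a complex structure, rotates every tangent plane by a right angle
(`smul_quat_eq`): the surface is a complex curve for `K`.

*The boundary.* The conormal `μ = sin θ N + cos θ J N` is rotated by `K` to the unit tangent of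
the boundary curve `γ`, so `γ' = |γ'| M γ` with `M = K (sin θ + cos θ J)`. As `K` and `J`
anticommute, `M² = -1`, and therefore `γ` runs on a great circle, in the plane `P` spanned by
`γ 0` and `M (γ 0)` (`differential_rot_eq`, `inner_eq_zero_of_hasDerivAt`).

*The interior.* For `n ⟂ P` put `u = ⟨n, ι⟩` and `v = ⟨K n, ι⟩`. Since tangent planes are
`K`-complex, `du ∧ dv = |du|² dA ≥ 0` (`mul_wedge_eq`). As `u = 0` on the boundary, Stokes' theorem gives
`∫ du ∧ dv = 0` (`jacobian_eq_zero`), hence `du = 0` and `u = 0`: the surface lies in `P`.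

*Surjectivity.* The map from the disk into the unit disk of `P` is open off finitely many points and
sends the boundary to the unit circle. The open unit disk minus finitely many points is connected,
so the image is the whole closed unit disk of `P` (`closedBall_subset_image`).
-/

namespace CapillaryLagrangian

open Metric Set

/-! ### Linear algebra of `ℂ²` in real coordinates -/

theorem inner_eq_sum (u v : R4) :
    ⟪u, v⟫_ℝ = u 0 * v 0 + u 1 * v 1 + u 2 * v 2 + u 3 * v 3 := by
  simp [PiLp.inner_apply, Fin.sum_univ_four]
  ring

/-- The real part of the holomorphic volume form `dz₁ ∧ dz₂`, with `z_k = x_k + i y_k`. -/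
def volRe (u v : R4) : ℝ := u 0 * v 1 - u 2 * v 3 - u 1 * v 0 + u 3 * v 2

/-- The imaginary part of the holomorphic volume form `dz₁ ∧ dz₂`. -/
def volIm (u v : R4) : ℝ := u 0 * v 3 + u 2 * v 1 - u 1 * v 2 - u 3 * v 0

/-- The map `z ↦ c j(z)` of `ℂ²`, where `c = p + i q` and `j (z₁, z₂) = (-z̄₂, z̄₁)` is the
quaternionic structure. It is antilinear over `ℂ`, and for `|c| = 1` it is an orthogonal complex
structure of `ℝ⁴`. -/
def quat (p q : ℝ) : R4 →ₗ[ℝ] R4 where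
  toFun u := !₂[-p * u 1 - q * u 3, p * u 0 + q * u 2, p * u 3 - q * u 1, q * u 0 - p * u 2]
  map_add' u v := by
    ext i
    fin_cases i <;> simp <;> ring
  map_smul' c u := by
    ext i
    fin_cases i <;> simp <;> ring

theorem inner_quat_left (p q : ℝ) (u v : R4) : ⟪quat p q u, v⟫_ℝ = -⟪u, quat p q v⟫_ℝ := by
  simp only [inner_eq_sum, quat, LinearMap.coe_mk, AddHom.coe_mk]
  simp
  ring

theorem quat_quat {p q : ℝ} (h : p ^ 2 + q ^ 2 = 1) (u : R4) : quat p q (quat p q u) = -u := by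
  ext i
  fin_cases i <;> simp [quat]
  · linear_combination (-u 0) * h
  · linear_combination (-u 1) * h
  · linear_combination (-u 2) * h
  · linear_combination (-u 3) * h

theorem quat_J (p q : ℝ) (u : R4) : quat p q (J u) = -J (quat p q u) := by
  ext i
  fin_cases i <;> simp [quat, J] <;> ring

theorem J_J (u : R4) : J (J u) = -u := by
  ext i
  fin_cases i <;> simp [J]

/-- On a Lagrangian plane of phase `p + i q`, the map `quat p q` is the rotation by a right
angle: it turns `a` into the part of `b` orthogonal to `a`, suitably scaled. -/
theorem smul_quat_eq {p q s : ℝ} {a b : R4} (h : omega a b = 0) (hr : volRe a b = s * p)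
    (hi : volIm a b = s * q) : s • quat p q a = ⟪a, a⟫_ℝ • b - ⟪a, b⟫_ℝ • a := by
  simp only [omega, volRe, volIm] at h hr hi
  ext i
  simp only [inner_eq_sum]
  fin_cases i <;> simp [quat]
  · linear_combination a 1 * hr + a 3 * hi + a 2 * h
  · linear_combination (-a 0) * hr - a 2 * hi + a 3 * h
  · linear_combination (-a 3) * hr + a 1 * hi - a 0 * h
  · linear_combination a 2 * hr - a 0 * hi - a 1 * h

theorem volRe_swap (a b : R4) : volRe b a = -volRe a b := by
  simp only [volRe]; ring

theorem volIm_swap (a b : R4) : volIm b a = -volIm a b := by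
  simp only [volIm]; ring

theorem omega_swap (a b : R4) : omega b a = -omega a b := by
  simp only [omega]; ring

/-- The identity of Lagrange and Cauchy–Binet in `ℂ²`. -/
theorem volRe_sq_add_volIm_sq (a b : R4) :
    volRe a b ^ 2 + volIm a b ^ 2 = ⟪a, a⟫_ℝ * ⟪b, b⟫_ℝ - ⟪a, b⟫_ℝ ^ 2 - omega a b ^ 2 := by
  simp only [inner_eq_sum, volRe, volIm, omega]; ring

/-- The polarized Cauchy–Binet identity. It gives the derivative of the phase of the volume form
on a Lagrangian plane with orthonormal basis `(a, b)` when the first vector varies. -/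
theorem volRe_mul_volIm_sub (a b x : R4) :
    volRe a b * volIm x b - volIm a b * volRe x b =
      omega a x * ⟪b, b⟫_ℝ - omega b x * ⟪a, b⟫_ℝ - omega a b * ⟪x, b⟫_ℝ := by
  simp only [inner_eq_sum, volRe, volIm, omega]; ring

theorem omega_add_left (a b c : R4) : omega (a + b) c = omega a c + omega b c := by
  simp only [omega, PiLp.add_apply]; ring

/-- For a Lagrangian plane spanned by `a, b` of phase `p + i q`, the two-form
`⟨n, ·⟩ ∧ ⟨quat p q n, ·⟩` is the squared length of the form `⟨n, ·⟩` times the area form. -/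
theorem mul_wedge_eq {p q s : ℝ} {a b : R4} (h : omega a b = 0) (hr : volRe a b = s * p)
    (hi : volIm a b = s * q) (n : R4) :
    s * (⟪n, a⟫_ℝ * ⟪quat p q n, b⟫_ℝ - ⟪n, b⟫_ℝ * ⟪quat p q n, a⟫_ℝ) =
      ⟪⟪n, a⟫_ℝ • b - ⟪n, b⟫_ℝ • a, ⟪n, a⟫_ℝ • b - ⟪n, b⟫_ℝ • a⟫_ℝ := by
  have ha := congrArg (fun z => ⟪n, z⟫_ℝ) (smul_quat_eq h hr hi)
  have hb := congrArg (fun z => ⟪n, z⟫_ℝ) (smul_quat_eq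
    (a := b) (b := a) (s := -s) (p := p) (q := q)
    (by rw [omega_swap, h, neg_zero]) (by rw [volRe_swap, hr, neg_mul])
    (by rw [volIm_swap, hi, neg_mul]))
  simp only [inner_smul_right, inner_sub_right, inner_sub_left, inner_smul_left, conj_trivial,
    inner_quat_left] at ha hb ⊢
  rw [real_inner_comm a b] at hb ⊢
  linear_combination ⟪n, a⟫_ℝ * hb + ⟪n, b⟫_ℝ * ha

/-! ### The standard basis of the plane -/

/-- The first standard basis vector of the plane. -/
noncomputable def e₁ : R2 := EuclideanSpace.single 0 1

/-- The second standard basis vector of the plane. -/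
noncomputable def e₂ : R2 := EuclideanSpace.single 1 1

@[simp] theorem e₁_zero : e₁ 0 = 1 := by simp [e₁]
@[simp] theorem e₁_one : e₁ 1 = 0 := by simp [e₁]
@[simp] theorem e₂_zero : e₂ 0 = 0 := by simp [e₂]
@[simp] theorem e₂_one : e₂ 1 = 1 := by simp [e₂]

theorem eq_smul_add_smul (v : R2) : v = v 0 • e₁ + v 1 • e₂ := by
  ext i
  fin_cases i <;> simp [e₁, e₂]

theorem wedge_apply (L M : R2 →L[ℝ] ℝ) (v w : R2) :
    L v * M w - L w * M v = (v 0 * w 1 - v 1 * w 0) * (L e₁ * M e₂ - L e₂ * M e₁) := by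
  conv_lhs => rw [eq_smul_add_smul v, eq_smul_add_smul w]
  simp only [map_add, map_smul, smul_eq_mul]
  ring

theorem volRe_map (A : R2 →L[ℝ] R4) (v w : R2) :
    volRe (A v) (A w) = (v 0 * w 1 - v 1 * w 0) * volRe (A e₁) (A e₂) := by
  conv_lhs => rw [eq_smul_add_smul v, eq_smul_add_smul w]
  simp only [map_add, map_smul, volRe, PiLp.add_apply, PiLp.smul_apply, smul_eq_mul]
  ring

theorem volIm_map (A : R2 →L[ℝ] R4) (v w : R2) :
    volIm (A v) (A w) = (v 0 * w 1 - v 1 * w 0) * volIm (A e₁) (A e₂) := by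
  conv_lhs => rw [eq_smul_add_smul v, eq_smul_add_smul w]
  simp only [map_add, map_smul, volIm, PiLp.add_apply, PiLp.smul_apply, smul_eq_mul]
  ring

theorem inner_R2 (v w : R2) : ⟪v, w⟫_ℝ = v 0 * w 0 + v 1 * w 1 := by
  simp [PiLp.inner_apply, Fin.sum_univ_two]
  ring

/-- An injective differential on a Lagrangian plane has nonzero complex volume. -/
theorem volRe_sq_add_volIm_sq_pos {A : R2 →L[ℝ] R4} (hA : Function.Injective A)
    (h : omega (A e₁) (A e₂) = 0) :
    0 < volRe (A e₁) (A e₂) ^ 2 + volIm (A e₁) (A e₂) ^ 2 := by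
  rcases (add_nonneg (sq_nonneg (volRe (A e₁) (A e₂)))
    (sq_nonneg (volIm (A e₁) (A e₂)))).lt_or_eq with h0 | h0
  · exact h0
  · exfalso
    have hr : volRe (A e₁) (A e₂) = 0 := by nlinarith [sq_nonneg (volIm (A e₁) (A e₂))]
    have hi : volIm (A e₁) (A e₂) = 0 := by nlinarith [sq_nonneg (volRe (A e₁) (A e₂))]
    have h1 := smul_quat_eq (p := 1) (q := 1) (s := 0) h (by simpa using hr) (by simpa using hi)
    rw [zero_smul, ← map_smul, ← map_smul, ← map_sub, eq_comm,
      map_eq_zero_iff A hA] at h1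
    have h2 : ⟪A e₁, A e₁⟫_ℝ = 0 := by
      simpa [e₁, e₂] using congrArg (fun z : R2 => z 1) h1
    rw [inner_self_eq_zero, map_eq_zero_iff A hA] at h2
    simpa [e₁] using congrArg (fun z : R2 => z 0) h2

/-! ### Calculus on the closed disk -/

theorem ball_subset_disk : ball (0 : R2) 1 ⊆ disk := ball_subset_closedBall

theorem circle_subset_disk : circle ⊆ disk := sphere_subset_closedBall

theorem disk_mem_nhds {x : R2} (hx : x ∈ ball (0 : R2) 1) : disk ∈ nhds x :=
  Filter.mem_of_superset (isOpen_ball.mem_nhds hx) ball_subset_disk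

theorem interior_disk : interior disk = ball 0 1 := interior_closedBall _ one_ne_zero

theorem convex_disk : Convex ℝ disk := convex_closedBall _ _

theorem uniqueDiffOn_disk : UniqueDiffOn ℝ disk :=
  uniqueDiffOn_convex convex_disk ⟨0, by rw [interior_disk]; exact mem_ball_self one_pos⟩

section Differential

variable {ι : R2 → R4}

theorem hasFDerivWithinAt_differential (h : ContDiffOn ℝ 2 ι disk) {x : R2} (hx : x ∈ disk) :
    HasFDerivWithinAt ι (differential ι x) disk x :=
  (h.differentiableOn (by norm_num) x hx).hasFDerivWithinAt

theorem hasFDerivAt_differential (h : ContDiffOn ℝ 2 ι disk) {x : R2}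
    (hx : x ∈ ball (0 : R2) 1) : HasFDerivAt ι (differential ι x) x :=
  (hasFDerivWithinAt_differential h (ball_subset_disk hx)).hasFDerivAt (disk_mem_nhds hx)

theorem contDiffOn_differential (h : ContDiffOn ℝ 2 ι disk) :
    ContDiffOn ℝ 1 (differential ι) disk :=
  h.fderivWithin uniqueDiffOn_disk (by norm_num)

theorem hasFDerivAt_secondDerivative (h : ContDiffOn ℝ 2 ι disk) {x : R2}
    (hx : x ∈ ball (0 : R2) 1) : HasFDerivAt (differential ι) (secondDerivative ι x) x :=
  ((contDiffOn_differential h).differentiableOn (by norm_num) x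
    (ball_subset_disk hx)).hasFDerivWithinAt.hasFDerivAt (disk_mem_nhds hx)

theorem secondDerivative_symm (h : ContDiffOn ℝ 2 ι disk) {x : R2}
    (hx : x ∈ ball (0 : R2) 1) (v w : R2) :
    secondDerivative ι x v w = secondDerivative ι x w v :=
  (h x (ball_subset_disk hx)).isSymmSndFDerivWithinAt (by simp) uniqueDiffOn_disk
    (by rw [interior_disk]; exact subset_closure hx) (ball_subset_disk hx) v w

theorem hasFDerivAt_differential_apply (h : ContDiffOn ℝ 2 ι disk) {x : R2}
    (hx : x ∈ ball (0 : R2) 1) (v : R2) (i : Fin 4) :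
    HasFDerivAt (fun y => differential ι y v i)
      ((EuclideanSpace.proj i : R4 →L[ℝ] ℝ) ∘L ((secondDerivative ι x).flip v)) x := by
  have h1 : HasFDerivAt (fun y => differential ι y v) ((secondDerivative ι x).flip v) x := by
    have := (hasFDerivAt_secondDerivative h hx).clm_apply (hasFDerivAt_const v x)
    convert! this using 1
    ext w
    simp
  exact (EuclideanSpace.proj i : R4 →L[ℝ] ℝ).hasFDerivAt.comp x h1

end Differential

/-- A ball of radius one in a space of dimension at least two stays connected when countably many
points are removed. -/
theorem isPreconnected_ball_diff_countable {E : Type*} [NormedAddCommGroup E]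
    [NormedSpace ℝ E] (hE : 1 < Module.rank ℝ E) {S : Set E} (hS : S.Countable) :
    IsPreconnected (ball (0 : E) 1 \ S) := by
  let φ : E → E := fun x => (Homeomorph.unitBall x : E)
  have hφ : Continuous φ := continuous_subtype_val.comp Homeomorph.unitBall.continuous
  have hinj : Function.Injective φ :=
    Subtype.val_injective.comp Homeomorph.unitBall.injective
  have hcon := (Set.Countable.isConnected_compl_of_one_lt_rank hE
    (hS.preimage_of_injOn hinj.injOn)).isPreconnected.image φ hφ.continuousOn
  convert hcon using 1
  ext y
  constructor
  · rintro ⟨hy, hyS⟩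
    refine ⟨Homeomorph.unitBall.symm ⟨y, hy⟩, ?_, ?_⟩ <;> simp [φ, hyS]
  · rintro ⟨x, hx, rfl⟩
    exact ⟨(Homeomorph.unitBall x).2, hx⟩

theorem disk_subset_closure_ball_diff {S : Set R2} (hS : S.Finite) :
    disk ⊆ closure (ball (0 : R2) 1 \ S) := by
  have h1 := (hS.countable.dense_compl ℝ).open_subset_closure_inter
    (isOpen_ball (x := (0 : R2)) (ε := 1))
  calc disk = closure (ball 0 1) := (closure_ball 0 one_ne_zero).symm
    _ ⊆ closure (ball 0 1 ∩ Sᶜ) := closure_minimal h1 isClosed_closure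

/-- Two continuous functions on the disk agree if they agree in the interior off a finite set. -/
theorem eq_on_disk_of_eq_off_finite {Y : Type*} [TopologicalSpace Y] [T2Space Y] {f g : R2 → Y}
    (hf : ContinuousOn f disk) (hg : ContinuousOn g disk) {S : Set R2} (hS : S.Finite)
    (h : ∀ x ∈ ball (0 : R2) 1 \ S, f x = g x) {x : R2} (hx : x ∈ disk) : f x = g x :=
  Set.EqOn.of_subset_closure h hf hg (sdiff_subset.trans ball_subset_disk)
    (disk_subset_closure_ball_diff hS) hx

/-! ### The phase of a minimal Lagrangian surface is constant -/

section Phase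

variable {ι : R2 → R4}

theorem omega_secondDerivative (h : ContDiffOn ℝ 2 ι disk) (hL : IsLagrangian ι) {x : R2}
    (hx : x ∈ ball (0 : R2) 1) (u v w : R2) :
    omega (secondDerivative ι x u v) (differential ι x w) +
      omega (differential ι x v) (secondDerivative ι x u w) = 0 := by
  have hd := fun z i => hasFDerivAt_differential_apply h hx z i
  have h1 := (((hd v 0).mul (hd w 2)).sub ((hd v 2).mul (hd w 0))).add
    (((hd v 1).mul (hd w 3)).sub ((hd v 3).mul (hd w 1)))
  have h2 := h1.congr_of_eventuallyEq (f₁ := fun _ => (0 : ℝ))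
    (Filter.eventually_of_mem (disk_mem_nhds hx) fun y hy => (hL y hy v w).symm)
  have h3 := congrArg (fun L : R2 →L[ℝ] ℝ => L u) (h2.unique (hasFDerivAt_const 0 x))
  simp at h3
  simp only [omega]
  linear_combination h3

/-- The trace of the second derivative over an orthonormal frame is tangent to a minimal
surface. -/
theorem omega_trace_secondDerivative (hL : IsLagrangian ι) (hm : IsMinimal ι) {x : R2}
    (hx : x ∈ regularPoints ι) {e : Fin 2 → R2}
    (he : Orthonormal ℝ fun i => differential ι x (e i)) (w : R2) :
    omega (secondDerivative ι x (e 0) (e 0)) (differential ι x w) +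
      omega (secondDerivative ι x (e 1) (e 1)) (differential ι x w) = 0 := by
  have h1 := hm x hx e he
  rw [Fin.sum_univ_two, secondFundamentalForm, secondFundamentalForm, ← map_add,
    Submodule.starProjection_apply_eq_zero_iff, Submodule.orthogonal_orthogonal] at h1
  obtain ⟨z, hz⟩ := h1
  rw [← omega_add_left, ← hz]
  exact hL x hx.1 z w

theorem exists_orthonormal_differential {A : R2 →L[ℝ] R4} (hA : Function.Injective A) :
    ∃ e : Fin 2 → R2, Orthonormal ℝ fun i => A (e i) := by
  have hdim : Module.finrank ℝ (LinearMap.range A.toLinearMap) = 2 := by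
    rw [LinearMap.finrank_range_of_inj hA]
    simp
  let B := (stdOrthonormalBasis ℝ (LinearMap.range A.toLinearMap)).reindex (finCongr hdim)
  choose e he using fun i => (B i).2
  refine ⟨e, ?_⟩
  have h1 := B.orthonormal.comp_linearIsometry (LinearMap.range A.toLinearMap).subtypeₗᵢ
  convert! h1 using 2 with i
  exact he i

/-- The derivative of the phase: `Im (conj f · df) = 0` for `f = dz₁ ∧ dz₂ (∂₁ι, ∂₂ι)`. In an
orthonormal frame the derivative of the phase in the direction `w` is the trace of the cubic form
`⟨h (·, ·), J dι w⟩`, which is the mean curvature paired with `J dι w`. -/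
theorem phase_derivative_eq_zero (h : ContDiffOn ℝ 2 ι disk) (hL : IsLagrangian ι)
    (hm : IsMinimal ι) {x : R2} (hx : x ∈ ball (0 : R2) 1) (hxr : x ∈ regularPoints ι) (w : R2) :
    volRe (differential ι x e₁) (differential ι x e₂) *
        (volIm (secondDerivative ι x w e₁) (differential ι x e₂) +
          volIm (differential ι x e₁) (secondDerivative ι x w e₂)) -
      volIm (differential ι x e₁) (differential ι x e₂) *
        (volRe (secondDerivative ι x w e₁) (differential ι x e₂) +
          volRe (differential ι x e₁) (secondDerivative ι x w e₂)) = 0 := by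
  obtain ⟨e, he⟩ := exists_orthonormal_differential hxr.2
  set A := differential ι x with hA
  set B := secondDerivative ι x with hB
  have hω : omega (A (e 0)) (A (e 1)) = 0 := hL x hxr.1 _ _
  have h00 : ⟪A (e 0), A (e 0)⟫_ℝ = 1 := by
    rw [real_inner_self_eq_norm_sq, he.1 0, one_pow]
  have h11 : ⟪A (e 1), A (e 1)⟫_ℝ = 1 := by
    rw [real_inner_self_eq_norm_sq, he.1 1, one_pow]
  have h01 : ⟪A (e 0), A (e 1)⟫_ℝ = 0 := he.2 (by decide)
  have h10 : ⟪A (e 1), A (e 0)⟫_ℝ = 0 := he.2 (by decide)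
  -- The Lagrangian condition makes `⟨B (u, v), J A w⟩` totally symmetric.
  have hsym : ∀ k : Fin 2, omega (A (e k)) (B w (e k)) =
      -omega (B (e k) (e k)) (A w) := by
    intro k
    have h1 := omega_secondDerivative h hL hx (e k) (e k) w
    rw [secondDerivative_symm h hx w (e k)]
    linear_combination h1
  have htr := omega_trace_secondDerivative hL hm hxr he w
  have key : volRe (A (e 0)) (A (e 1)) * (volIm (B w (e 0)) (A (e 1)) + volIm (A (e 0)) (B w (e 1)))
      - volIm (A (e 0)) (A (e 1)) * (volRe (B w (e 0)) (A (e 1)) + volRe (A (e 0)) (B w (e 1)))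
      = 0 := by
    have k1 := volRe_mul_volIm_sub (A (e 0)) (A (e 1)) (B w (e 0))
    have k2 := volRe_mul_volIm_sub (A (e 1)) (A (e 0)) (B w (e 1))
    rw [hω, h11, h01] at k1
    rw [omega_swap (A (e 0)) (A (e 1)), hω, h00, h10, volRe_swap (A (e 0)) (A (e 1)),
      volIm_swap (A (e 0)) (A (e 1)), volRe_swap (A (e 0)), volIm_swap (A (e 0))] at k2
    linear_combination k1 + k2 + hsym 0 + hsym 1 - htr
  -- Passing to the standard basis multiplies the complex volume by a real determinant.
  have hdet : ∀ v : Fin 2 → R2, ∀ F : R4 → R4 → ℝ, (F = volRe ∨ F = volIm) →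
      F (A (v 0)) (A (v 1)) = (v 0 0 * v 1 1 - v 0 1 * v 1 0) * F (A e₁) (A e₂) ∧
      F (B w (v 0)) (A (v 1)) + F (A (v 0)) (B w (v 1)) =
        (v 0 0 * v 1 1 - v 0 1 * v 1 0) * (F (B w e₁) (A e₂) + F (A e₁) (B w e₂)) := by
    rintro v F (rfl | rfl)
    · refine ⟨volRe_map A _ _, ?_⟩
      conv_lhs => rw [eq_smul_add_smul (v 0), eq_smul_add_smul (v 1)]
      simp only [map_add, map_smul, volRe, PiLp.add_apply, PiLp.smul_apply, smul_eq_mul]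
      ring
    · refine ⟨volIm_map A _ _, ?_⟩
      conv_lhs => rw [eq_smul_add_smul (v 0), eq_smul_add_smul (v 1)]
      simp only [map_add, map_smul, volIm, PiLp.add_apply, PiLp.smul_apply, smul_eq_mul]
      ring
  obtain ⟨r1, r2⟩ := hdet e volRe (Or.inl rfl)
  obtain ⟨i1, i2⟩ := hdet e volIm (Or.inr rfl)
  have hne : e 0 0 * e 1 1 - e 0 1 * e 1 0 ≠ 0 := by
    intro h0
    have := volRe_sq_add_volIm_sq (A (e 0)) (A (e 1))
    rw [r1, i1, h0, hω, h00, h11, h01] at this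
    norm_num at this
  rw [r1, r2, i1, i2] at key
  have : (e 0 0 * e 1 1 - e 0 1 * e 1 0) ^ 2 ≠ 0 := pow_ne_zero 2 hne
  refine mul_left_cancel₀ this ?_
  linear_combination key

/-- The real part of the complex volume `dz₁ ∧ dz₂ (∂₁ι, ∂₂ι)`. -/
noncomputable def jacRe (ι : R2 → R4) (x : R2) : ℝ :=
  volRe (differential ι x e₁) (differential ι x e₂)

/-- The imaginary part of the complex volume `dz₁ ∧ dz₂ (∂₁ι, ∂₂ι)`. -/
noncomputable def jacIm (ι : R2 → R4) (x : R2) : ℝ :=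
  volIm (differential ι x e₁) (differential ι x e₂)

/-- The modulus of the complex volume; for a Lagrangian map this is the area density. -/
noncomputable def density (ι : R2 → R4) (x : R2) : ℝ := √(jacRe ι x ^ 2 + jacIm ι x ^ 2)

theorem density_pos (hL : IsLagrangian ι) {x : R2} (hx : x ∈ regularPoints ι) :
    0 < density ι x :=
  Real.sqrt_pos.2 (volRe_sq_add_volIm_sq_pos hx.2 (hL x hx.1 _ _))

theorem density_sq (ι : R2 → R4) (x : R2) : density ι x ^ 2 = jacRe ι x ^ 2 + jacIm ι x ^ 2 :=
  Real.sq_sqrt (by positivity)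

theorem continuousOn_differential_apply (h : ContDiffOn ℝ 2 ι disk) (v : R2) :
    ContinuousOn (fun x => differential ι x v) disk :=
  (contDiffOn_differential h).continuousOn.clm_apply continuousOn_const

theorem continuousOn_jac (h : ContDiffOn ℝ 2 ι disk) :
    ContinuousOn (jacRe ι) disk ∧ ContinuousOn (jacIm ι) disk := by
  have hc : ∀ v : R2, ∀ i : Fin 4, ContinuousOn (fun x => differential ι x v i) disk :=
    fun v i => (EuclideanSpace.proj i : R4 →L[ℝ] ℝ).continuous.comp_continuousOn
      (continuousOn_differential_apply h v)
  constructor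
  · exact ((((hc e₁ 0).mul (hc e₂ 1)).sub ((hc e₁ 2).mul (hc e₂ 3))).sub
      ((hc e₁ 1).mul (hc e₂ 0))).add ((hc e₁ 3).mul (hc e₂ 2))
  · exact ((((hc e₁ 0).mul (hc e₂ 3)).add ((hc e₁ 2).mul (hc e₂ 1))).sub
      ((hc e₁ 1).mul (hc e₂ 2))).sub ((hc e₁ 3).mul (hc e₂ 0))

theorem continuousOn_density (h : ContDiffOn ℝ 2 ι disk) : ContinuousOn (density ι) disk :=
  Real.continuous_sqrt.comp_continuousOn
    (((continuousOn_jac h).1.pow 2).add ((continuousOn_jac h).2.pow 2))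

theorem hasFDerivAt_jac (h : ContDiffOn ℝ 2 ι disk) {x : R2} (hx : x ∈ ball (0 : R2) 1) :
    (∃ L : R2 →L[ℝ] ℝ, HasFDerivAt (jacRe ι) L x ∧ ∀ w, L w =
      volRe (secondDerivative ι x w e₁) (differential ι x e₂) +
          volRe (differential ι x e₁) (secondDerivative ι x w e₂)) ∧
    ∃ L : R2 →L[ℝ] ℝ, HasFDerivAt (jacIm ι) L x ∧ ∀ w, L w =
      volIm (secondDerivative ι x w e₁) (differential ι x e₂) +
          volIm (differential ι x e₁) (secondDerivative ι x w e₂) := by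
  have hd := fun z i => hasFDerivAt_differential_apply h hx z i
  constructor
  · refine ⟨_, ((((hd e₁ 0).mul (hd e₂ 1)).sub ((hd e₁ 2).mul (hd e₂ 3))).sub
      ((hd e₁ 1).mul (hd e₂ 0))).add ((hd e₁ 3).mul (hd e₂ 2)), fun w => ?_⟩
    simp [volRe]
    ring
  · refine ⟨_, ((((hd e₁ 0).mul (hd e₂ 3)).add ((hd e₁ 2).mul (hd e₂ 1))).sub
      ((hd e₁ 1).mul (hd e₂ 2))).sub ((hd e₁ 3).mul (hd e₂ 0)), fun w => ?_⟩
    simp [volIm]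
    ring

/-- The derivative of `f / √(f² + g²)` vanishes where `f dg - g df = 0`. -/
theorem hasFDerivAt_div_sqrt {f g : R2 → ℝ} {f' g' : R2 →L[ℝ] ℝ} {x : R2}
    (hf : HasFDerivAt f f' x) (hg : HasFDerivAt g g' x) (hpos : 0 < f x ^ 2 + g x ^ 2)
    (h : ∀ w, f x * g' w - g x * f' w = 0) :
    HasFDerivAt (fun y => f y / √(f y ^ 2 + g y ^ 2)) (0 : R2 →L[ℝ] ℝ) x := by
  have hs : 0 < √(f x ^ 2 + g x ^ 2) := Real.sqrt_pos.2 hpos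
  have h1 := hf.mul ((hasDerivAt_inv hs.ne').comp_hasFDerivAt x
    (((hf.pow 2).add (hg.pow 2)).sqrt hpos.ne'))
  simp only [div_eq_mul_inv]
  convert! h1 using 1
  ext w
  have hsq := Real.sq_sqrt hpos.le
  simp
  set s := √(f x ^ 2 + g x ^ 2)
  field_simp
  rw [hsq]
  linear_combination g x * h w

/-- A minimal Lagrangian surface has constant phase: the complex volume `dz₁ ∧ dz₂ (∂₁ι, ∂₂ι)` is
the area density times a fixed complex number `p + i q` of modulus one, across branch points
too. -/
theorem exists_phase (hb : IsBranchedImmersion ι) (hL : IsLagrangian ι) (hm : IsMinimal ι) :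
    ∃ p q : ℝ, p ^ 2 + q ^ 2 = 1 ∧
      ∀ x ∈ disk, jacRe ι x = density ι x * p ∧ jacIm ι x = density ι x * q := by
  have h := hb.contDiffOn
  set S := disk \ regularPoints ι with hS
  set O := ball (0 : R2) 1 \ S with hO
  have hOr : ∀ x ∈ O, x ∈ ball (0 : R2) 1 ∧ x ∈ regularPoints ι := fun x hx =>
    ⟨hx.1, by_contra fun hn => hx.2 ⟨ball_subset_disk hx.1, hn⟩⟩
  have hOopen : IsOpen O := isOpen_ball.sdiff hb.finite_branch.isClosed
  have hOconn : IsPreconnected O := isPreconnected_ball_diff_countable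
    (by rw [rank_eq_card_basis (EuclideanSpace.basisFun (Fin 2) ℝ).toBasis]; simp)
    hb.finite_branch.countable
  obtain ⟨x₀, hx₀⟩ : O.Nonempty := by
    by_contra hne
    have := disk_subset_closure_ball_diff hb.finite_branch
      (ball_subset_disk (mem_ball_self one_pos))
    rw [← hS, ← hO, Set.not_nonempty_iff_eq_empty.1 hne] at this
    simp at this
  have hder : ∀ x ∈ O, HasFDerivAt (fun y => jacRe ι y / density ι y) (0 : R2 →L[ℝ] ℝ) x ∧
      HasFDerivAt (fun y => jacIm ι y / density ι y) (0 : R2 →L[ℝ] ℝ) x := by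
    intro x hx
    obtain ⟨hxb, hxr⟩ := hOr x hx
    obtain ⟨⟨L, hLd, hLw⟩, ⟨M, hMd, hMw⟩⟩ := hasFDerivAt_jac h hxb
    have hz : ∀ w, jacRe ι x * M w - jacIm ι x * L w = 0 := by
      intro w
      rw [hLw, hMw]
      exact phase_derivative_eq_zero h hL hm hxb hxr w
    have hpos : 0 < jacRe ι x ^ 2 + jacIm ι x ^ 2 :=
      volRe_sq_add_volIm_sq_pos hxr.2 (hL x hxr.1 _ _)
    refine ⟨hasFDerivAt_div_sqrt hLd hMd hpos hz, ?_⟩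
    have := hasFDerivAt_div_sqrt hMd hLd (by rwa [add_comm]) fun w => by
      linear_combination -hz w
    simpa only [density, add_comm] using this
  have hconst : ∀ F : R2 → ℝ, (∀ x ∈ O, HasFDerivAt F (0 : R2 →L[ℝ] ℝ) x) →
      ∀ x ∈ O, F x = F x₀ := fun F hF x hx =>
    hOopen.is_const_of_fderiv_eq_zero hOconn
      (fun y hy => (hF y hy).differentiableAt.differentiableWithinAt)
      (fun y hy => (hF y hy).fderiv) hx hx₀
  refine ⟨jacRe ι x₀ / density ι x₀, jacIm ι x₀ / density ι x₀, ?_, fun x hx => ⟨?_, ?_⟩⟩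
  · have := (density_pos hL (hOr x₀ hx₀).2).ne'
    field_simp
    exact (density_sq ι x₀).symm
  · refine eq_on_disk_of_eq_off_finite (continuousOn_jac h).1
      ((continuousOn_density h).mul continuousOn_const) hb.finite_branch (fun y hy => ?_) hx
    have := (density_pos hL (hOr y hy).2).ne'
    have hy' := hconst _ (fun z hz => (hder z hz).1) y hy
    simp only [Pi.mul_apply, ← hy']
    field_simp
  · refine eq_on_disk_of_eq_off_finite (continuousOn_jac h).2
      ((continuousOn_density h).mul continuousOn_const) hb.finite_branch (fun y hy => ?_) hx
    have := (density_pos hL (hOr y hy).2).ne'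
    have hy' := hconst _ (fun z hz => (hder z hz).2) y hy
    simp only [Pi.mul_apply, ← hy']
    field_simp

end Phase

/-! ### Stokes' theorem on the disk in polar coordinates -/

/-- The polar coordinate map `(r, t) ↦ r (cos t, sin t)`. -/
noncomputable def polar (z : ℝ × ℝ) : R2 :=
  (z.1 * Real.cos z.2) • e₁ + (z.1 * Real.sin z.2) • e₂

/-- The radial derivative of the polar coordinate map. -/
noncomputable def polarR (z : ℝ × ℝ) : R2 := Real.cos z.2 • e₁ + Real.sin z.2 • e₂

/-- The angular derivative of the polar coordinate map. -/
noncomputable def polarT (z : ℝ × ℝ) : R2 :=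
  (-(z.1 * Real.sin z.2)) • e₁ + (z.1 * Real.cos z.2) • e₂

theorem contDiff_polar : ContDiff ℝ 2 polar := by
  unfold polar
  fun_prop

theorem continuous_polarR : Continuous polarR := by
  unfold polarR
  fun_prop

theorem continuous_polarT : Continuous polarT := by
  unfold polarT
  fun_prop

theorem hasFDerivAt_polar (z : ℝ × ℝ) :
    ∃ L : ℝ × ℝ →L[ℝ] R2, HasFDerivAt polar L z ∧ L (1, 0) = polarR z ∧ L (0, 1) = polarT z := by
  have h1 : HasFDerivAt (fun z : ℝ × ℝ => z.1) (ContinuousLinearMap.fst ℝ ℝ ℝ) z :=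
    hasFDerivAt_fst
  have h2 : HasFDerivAt (fun z : ℝ × ℝ => z.2) (ContinuousLinearMap.snd ℝ ℝ ℝ) z :=
    hasFDerivAt_snd
  refine ⟨_, ((h1.mul h2.cos).smul_const e₁).add ((h1.mul h2.sin).smul_const e₂), ?_, ?_⟩
  · simp [polarR]
  · simp [polarT]

theorem norm_polar (z : ℝ × ℝ) : ‖polar z‖ = |z.1| := by
  rw [← sq_eq_sq₀ (norm_nonneg _) (abs_nonneg _), sq_abs, ← real_inner_self_eq_norm_sq, inner_R2]
  simp [polar]
  linear_combination z.1 ^ 2 * Real.sin_sq_add_cos_sq z.2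

theorem exists_polar (x : R2) : ∃ t ∈ Icc (-Real.pi) Real.pi, polar (‖x‖, t) = x := by
  set c : ℂ := ⟨x 0, x 1⟩ with hc
  have hn : ‖c‖ = ‖x‖ := by
    rw [EuclideanSpace.norm_eq, Fin.sum_univ_two, Complex.norm_def, Complex.normSq_apply]
    simp [hc, sq]
  refine ⟨c.arg, ⟨(Complex.neg_pi_lt_arg c).le, Complex.arg_le_pi c⟩, ?_⟩
  rw [polar, ← hn]
  simp only [Complex.norm_mul_cos_arg, Complex.norm_mul_sin_arg]
  exact (eq_smul_add_smul x).symm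

/-- The rectangle of polar coordinates of the closed disk. -/
def polarBox : Set (ℝ × ℝ) := Icc (0, -Real.pi) (1, Real.pi)

theorem interior_polarBox : interior polarBox = Ioo 0 1 ×ˢ Ioo (-Real.pi) Real.pi := by
  rw [polarBox, ← Icc_prod_Icc, interior_prod_eq, interior_Icc, interior_Icc]

theorem mapsTo_polar : MapsTo polar polarBox disk := by
  rintro z ⟨hz1, hz2⟩
  rw [disk, mem_closedBall_zero_iff, norm_polar, abs_of_nonneg hz1.1]
  exact hz2.1

theorem mapsTo_polar_interior : MapsTo polar (interior polarBox) (ball 0 1) := by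
  rw [interior_polarBox]
  rintro z ⟨hz1, -⟩
  rw [mem_ball_zero_iff, norm_polar, abs_of_pos hz1.1]
  exact hz1.2

theorem polarBox_subset_closure_interior : polarBox ⊆ closure (interior polarBox) := by
  rw [interior_polarBox, closure_prod_eq, closure_Ioo zero_ne_one,
    closure_Ioo (by linarith [Real.pi_pos] : -Real.pi < Real.pi).ne, Icc_prod_Icc, polarBox]

/-- The coefficient of `du ∧ dv` with respect to the area form of the disk. -/
noncomputable def jacobian (u v : R2 → ℝ) (x : R2) : ℝ :=
  fderivWithin ℝ u disk x e₁ * fderivWithin ℝ v disk x e₂ -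
    fderivWithin ℝ u disk x e₂ * fderivWithin ℝ v disk x e₁

section Stokes

variable {u v : R2 → ℝ}

/-- The exterior derivative of `u dv` in polar coordinates, where the mixed second derivatives of
`v` cancel. -/
theorem divergence_polar (hu : ContDiffOn ℝ 2 u disk) (hv : ContDiffOn ℝ 2 v disk) {z : ℝ × ℝ}
    (hz : z ∈ interior polarBox) :
    ∃ f' g' : ℝ × ℝ →L[ℝ] ℝ,
      HasFDerivAt (fun y => u (polar y) * fderivWithin ℝ v disk (polar y) (polarT y)) f' z ∧
      HasFDerivAt (fun y => -(u (polar y) * fderivWithin ℝ v disk (polar y) (polarR y))) g' z ∧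
      f' (1, 0) + g' (0, 1) = z.1 * jacobian u v (polar z) := by
  have hdu : ∀ y ∈ interior polarBox,
      HasFDerivAt u (fderivWithin ℝ u disk (polar y)) (polar y) := fun y hy =>
    (hu.differentiableOn (by norm_num) _ (ball_subset_disk
      (mapsTo_polar_interior hy))).hasFDerivWithinAt.hasFDerivAt
      (disk_mem_nhds (mapsTo_polar_interior hy))
  have hdv : ∀ y ∈ interior polarBox,
      HasFDerivAt v (fderivWithin ℝ v disk (polar y)) (polar y) := fun y hy =>
    (hv.differentiableOn (by norm_num) _ (ball_subset_disk
      (mapsTo_polar_interior hy))).hasFDerivWithinAt.hasFDerivAt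
      (disk_mem_nhds (mapsTo_polar_interior hy))
  set V : ℝ × ℝ → ℝ := fun y => v (polar y) with hVdef
  have hVder : ∀ y ∈ interior polarBox,
      fderiv ℝ V y (1, 0) = fderivWithin ℝ v disk (polar y) (polarR y) ∧
      fderiv ℝ V y (0, 1) = fderivWithin ℝ v disk (polar y) (polarT y) := by
    intro y hy
    obtain ⟨L, hL, hR, hT⟩ := hasFDerivAt_polar y
    have := ((hdv y hy).comp y hL).fderiv
    change fderiv ℝ V y = _ at this
    rw [this]
    simp [hR, hT]
  have hVc : ContDiffAt ℝ 2 V z :=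
    (hv.contDiffAt (disk_mem_nhds (mapsTo_polar_interior hz))).comp z contDiff_polar.contDiffAt
  have hV2 : HasFDerivAt (fderiv ℝ V) (fderiv ℝ (fderiv ℝ V) z) z :=
    ((hVc.fderiv_right (m := 1) (by norm_num)).differentiableAt (by norm_num)).hasFDerivAt
  have hsymm : fderiv ℝ (fderiv ℝ V) z (1, 0) (0, 1) = fderiv ℝ (fderiv ℝ V) z (0, 1) (1, 0) :=
    hVc.isSymmSndFDerivAt (by simp) _ _
  have hV2a : ∀ w : ℝ × ℝ, HasFDerivAt (fun y => fderiv ℝ V y w)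
      ((fderiv ℝ (fderiv ℝ V) z).flip w) z := by
    intro w
    have := hV2.clm_apply (hasFDerivAt_const w z)
    convert! this using 1
    ext <;> simp
  obtain ⟨L, hL, hR, hT⟩ := hasFDerivAt_polar z
  have hU := (hdu z hz).comp z hL
  have hnhds : interior polarBox ∈ nhds z := isOpen_interior.mem_nhds hz
  refine ⟨_, _, (hU.mul (hV2a (0, 1))).congr_of_eventuallyEq
    (Filter.eventually_of_mem hnhds fun y hy => ?_),
    (hU.mul (hV2a (1, 0))).neg.congr_of_eventuallyEq
    (Filter.eventually_of_mem hnhds fun y hy => ?_), ?_⟩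
  · simp [(hVder y hy).2]
  · simp [(hVder y hy).1]
  · have hw := wedge_apply (fderivWithin ℝ u disk (polar z)) (fderivWithin ℝ v disk (polar z))
      (polarR z) (polarT z)
    have hd : polarR z 0 * polarT z 1 - polarR z 1 * polarT z 0 = z.1 := by
      simp [polarR, polarT]
      linear_combination z.1 * Real.sin_sq_add_cos_sq z.2
    rw [hd] at hw
    simp [hR, hT, (hVder z hz).1, (hVder z hz).2, hsymm, jacobian]
    linear_combination hw

/-- If `u` vanishes on the boundary circle and `du ∧ dv ≥ 0`, then `du ∧ dv = 0`: by Stokes'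
theorem the integral of `du ∧ dv` is that of `u dv` over the circle. -/
theorem jacobian_eq_zero (hu : ContDiffOn ℝ 2 u disk) (hv : ContDiffOn ℝ 2 v disk)
    (hu0 : ∀ x ∈ circle, u x = 0) (hpos : ∀ x ∈ disk, 0 ≤ jacobian u v x) {x : R2}
    (hx : x ∈ disk) (hx0 : x ≠ 0) : jacobian u v x = 0 := by
  have hDu : ContinuousOn (fderivWithin ℝ u disk) disk :=
    hu.continuousOn_fderivWithin uniqueDiffOn_disk (by norm_num)
  have hDv : ContinuousOn (fderivWithin ℝ v disk) disk :=
    hv.continuousOn_fderivWithin uniqueDiffOn_disk (by norm_num)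
  have hcp : ContinuousOn polar polarBox := contDiff_polar.continuous.continuousOn
  have hW : ContinuousOn (fun z : ℝ × ℝ => z.1 * jacobian u v (polar z)) polarBox := by
    refine continuousOn_fst.mul (ContinuousOn.comp (g := jacobian u v) (t := disk) ?_ hcp
      mapsTo_polar)
    exact ((hDu.clm_apply continuousOn_const).mul (hDv.clm_apply continuousOn_const)).sub
      ((hDu.clm_apply continuousOn_const).mul (hDv.clm_apply continuousOn_const))
  have huc : ContinuousOn (fun y => u (polar y)) polarBox :=
    hu.continuousOn.comp hcp mapsTo_polar
  have hDvc : ContinuousOn (fun y => fderivWithin ℝ v disk (polar y)) polarBox :=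
    hDv.comp hcp mapsTo_polar
  -- Off the open rectangle the derivatives are irrelevant; they are chosen to keep the
  -- divergence continuous on the closed rectangle.
  have hder : ∀ z : ℝ × ℝ, ∃ f' g' : ℝ × ℝ →L[ℝ] ℝ, (z ∈ interior polarBox →
      HasFDerivAt (fun y => u (polar y) * fderivWithin ℝ v disk (polar y) (polarT y)) f' z ∧
      HasFDerivAt (fun y => -(u (polar y) * fderivWithin ℝ v disk (polar y) (polarR y))) g' z) ∧
      f' (1, 0) + g' (0, 1) = z.1 * jacobian u v (polar z) := by
    intro z
    by_cases hz : z ∈ interior polarBox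
    · obtain ⟨f', g', h1, h2, h3⟩ := divergence_polar hu hv hz
      exact ⟨f', g', fun _ => ⟨h1, h2⟩, h3⟩
    · exact ⟨(z.1 * jacobian u v (polar z)) • ContinuousLinearMap.fst ℝ ℝ ℝ, 0,
        fun h => absurd h hz, by simp⟩
  choose f' g' hfg hsum using hder
  have hdiv := MeasureTheory.integral_divergence_prod_Icc_of_hasFDerivAt_of_le
    (fun y => u (polar y) * fderivWithin ℝ v disk (polar y) (polarT y))
    (fun y => -(u (polar y) * fderivWithin ℝ v disk (polar y) (polarR y)))
    f' g' (0, -Real.pi) (1, Real.pi)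
    ⟨zero_le_one, by linarith [Real.pi_pos]⟩
    (huc.mul (hDvc.clm_apply continuous_polarT.continuousOn))
    (huc.mul (hDvc.clm_apply continuous_polarR.continuousOn)).neg
    (fun z hz => (hfg z (by rw [interior_polarBox]; exact hz)).1)
    (fun z hz => (hfg z (by rw [interior_polarBox]; exact hz)).2)
    (by
      simp only [hsum]
      exact hW.integrableOn_compact isCompact_Icc)
  simp only [hsum] at hdiv
  have hr1 : ∀ y : ℝ, u (polar (1, y)) = 0 := fun y => hu0 _ (by
    rw [circle, mem_sphere_zero_iff_norm, norm_polar, abs_one])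
  have hr0 : ∀ y : ℝ, polarT (0, y) = 0 := fun y => by simp [polarT]
  have hper : ∀ r : ℝ, polar (r, -Real.pi) = polar (r, Real.pi) ∧
      polarR (r, -Real.pi) = polarR (r, Real.pi) := fun r => by simp [polar, polarR]
  simp [hr1, hr0, (hper _).1, (hper _).2] at hdiv
  have hnonneg : ∀ z ∈ polarBox, 0 ≤ z.1 * jacobian u v (polar z) := fun z hz =>
    mul_nonneg hz.1.1 (hpos _ (mapsTo_polar hz))
  have hae := (MeasureTheory.setIntegral_eq_zero_iff_of_nonneg_ae
    ((MeasureTheory.ae_restrict_iff' measurableSet_Icc).2 (Filter.Eventually.of_forall hnonneg))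
    (hW.integrableOn_compact isCompact_Icc)).1 hdiv
  have heq := MeasureTheory.Measure.eqOn_of_ae_eq hae hW continuousOn_const
    polarBox_subset_closure_interior
  obtain ⟨t, ht, htx⟩ := exists_polar x
  have hxn : ‖x‖ ≤ 1 := by simpa [disk] using hx
  have := heq (show ((‖x‖, t) : ℝ × ℝ) ∈ polarBox from ⟨⟨norm_nonneg x, ht.1⟩, ⟨hxn, ht.2⟩⟩)
  simp only [htx, Pi.zero_apply] at this
  exact (mul_eq_zero.1 this).resolve_left (norm_ne_zero_iff.2 hx0)

end Stokes

/-! ### The boundary is a great circle -/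

section Boundary

variable {ι : R2 → R4}

/-- The counterclockwise tangent vector to the circle through `x`. -/
noncomputable def rot (x : R2) : R2 := (-x 1) • e₁ + x 0 • e₂

theorem inner_rot (x : R2) : ⟪x, rot x⟫_ℝ = 0 := by
  simp [inner_R2, rot]
  ring

theorem eq_smul_rot {x w : R2} (hx : ‖x‖ = 1) (h : ⟪x, w⟫_ℝ = 0) : ∃ c : ℝ, w = c • rot x := by
  have hn : x 0 ^ 2 + x 1 ^ 2 = 1 := by
    rw [sq, sq, ← inner_R2, real_inner_self_eq_norm_sq, hx, one_pow]
  rw [inner_R2] at h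
  refine ⟨x 0 * w 1 - x 1 * w 0, ?_⟩
  ext i
  fin_cases i <;> simp [rot]
  · linear_combination (-w 0) * hn + x 0 * h
  · linear_combination (-w 1) * hn + x 1 * h

/-- The outward unit conormal, obtained by rotating the unit tangent vector of the boundary by a
right angle: `|b| μ = -K b` for `b = dι (rot x)`. -/
theorem exists_outwardConormal {p q : ℝ} (hpq : p ^ 2 + q ^ 2 = 1) (hL : IsLagrangian ι)
    {x : R2} (hx : x ∈ circle) (hxr : x ∈ regularPoints ι)
    (hr : jacRe ι x = density ι x * p) (hi : jacIm ι x = density ι x * q) :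
    ∃ μ : R4, IsOutwardConormal ι x μ ∧
      ‖differential ι x (rot x)‖ • μ = -quat p q (differential ι x (rot x)) := by
  set A := differential ι x with hA
  set b := A (rot x) with hb
  set s := density ι x with hs
  have hspos : 0 < s := density_pos hL hxr
  have hxn : ‖x‖ = 1 := by simpa [circle] using hx
  have hn : x 0 ^ 2 + x 1 ^ 2 = 1 := by
    rw [sq, sq, ← inner_R2, real_inner_self_eq_norm_sq, hxn, one_pow]
  have hdet : x 0 * rot x 1 - x 1 * rot x 0 = 1 := by
    simp [rot]
    linear_combination hn
  have hω : omega (A x) b = 0 := hL x hxr.1 _ _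
  have hr' : volRe (A x) b = s * p := by rw [hb, volRe_map, hdet, one_mul]; exact hr
  have hi' : volIm (A x) b = s * q := by rw [hb, volIm_map, hdet, one_mul]; exact hi
  have hK := smul_quat_eq (a := b) (b := A x) (s := -s) (p := p) (q := q)
    (by rw [omega_swap, hω, neg_zero]) (by rw [volRe_swap, hr', neg_mul])
    (by rw [volIm_swap, hi', neg_mul])
  have hb0 : 0 < ‖b‖ := by
    rw [norm_pos_iff]
    intro h0
    have := volRe_sq_add_volIm_sq (A x) b
    rw [hr', hi', h0] at this
    simp [omega] at this
    nlinarith [sq_pos_of_pos hspos]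
  have hKn : ⟪quat p q b, quat p q b⟫_ℝ = ⟪b, b⟫_ℝ := by
    rw [inner_quat_left, quat_quat hpq, inner_neg_right, neg_neg]
  have hKb : ⟪quat p q b, b⟫_ℝ = 0 := by
    have := inner_quat_left p q b b
    rw [real_inner_comm (quat p q b) b] at this
    linarith
  refine ⟨-‖b‖⁻¹ • quat p q b, ⟨?_, ⟨(‖b‖ * s)⁻¹ • (⟪b, b⟫_ℝ • x - ⟪b, A x⟫_ℝ • rot x), ?_, ?_⟩,
    ?_⟩, ?_⟩
  · rw [norm_smul, norm_neg, norm_inv, norm_norm]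
    have : ‖quat p q b‖ = ‖b‖ := by
      rw [← sq_eq_sq₀ (norm_nonneg _) (norm_nonneg _), ← real_inner_self_eq_norm_sq,
        ← real_inner_self_eq_norm_sq, hKn]
    rw [this, inv_mul_cancel₀ hb0.ne']
  · rw [inner_smul_right, inner_sub_right, inner_smul_right, inner_smul_right, inner_rot,
      real_inner_self_eq_norm_sq, real_inner_self_eq_norm_sq, hxn]
    simp only [mul_zero, sub_zero]
    positivity
  · rw [← hA, map_smul, map_sub, map_smul, map_smul, ← hb, ← hK, smul_smul]
    congr 1
    field_simp
  · intro w hw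
    obtain ⟨c, rfl⟩ := eq_smul_rot hxn hw
    rw [← hA, map_smul, ← hb, inner_smul_left, inner_smul_right, hKb, mul_zero, mul_zero]
  · rw [smul_smul, mul_neg, mul_inv_cancel₀ hb0.ne', neg_one_smul]

/-- The complex structure `M` with `γ' = |γ'| M γ` along the boundary curve `γ` of a surface of
phase `p + i q` and contact angle `θ`: the conormal is `sin θ γ + cos θ J γ`, and `quat p q`
rotates it to the tangent. -/
noncomputable def boundaryStructure (p q θ : ℝ) : R4 →ₗ[ℝ] R4 :=
  quat p q ∘ₗ (Real.sin θ • LinearMap.id + Real.cos θ • J)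

theorem boundaryStructure_apply (p q θ : ℝ) (u : R4) : boundaryStructure p q θ u =
    Real.sin θ • quat p q u + Real.cos θ • quat p q (J u) := by
  simp [boundaryStructure]

theorem boundaryStructure_sq {p q : ℝ} (hpq : p ^ 2 + q ^ 2 = 1) (θ : ℝ) (u : R4) :
    boundaryStructure p q θ (boundaryStructure p q θ u) = -u := by
  have h1 : quat p q (J (quat p q u)) = J u := by
    rw [quat_J, quat_quat hpq, map_neg, neg_neg]
  have h2 : quat p q (J (quat p q (J u))) = -u := by
    rw [quat_J, quat_quat hpq, map_neg, neg_neg, J_J]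
  simp only [boundaryStructure_apply, map_add, map_smul, quat_quat hpq, h1, h2]
  have := Real.sin_sq_add_cos_sq θ
  calc _ = (Real.sin θ ^ 2 + Real.cos θ ^ 2) • (-u) := by module
    _ = -u := by rw [this, one_smul]

theorem differential_rot_eq {p q θ : ℝ} (hpq : p ^ 2 + q ^ 2 = 1) (hL : IsLagrangian ι)
    (hθ : HasConstantContactAngle ι θ) {x : R2} (hx : x ∈ circle) (hxr : x ∈ regularPoints ι)
    (hr : jacRe ι x = density ι x * p) (hi : jacIm ι x = density ι x * q) :
    differential ι x (rot x) =
      ‖differential ι x (rot x)‖ • boundaryStructure p q θ (ι x) := by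
  obtain ⟨μ, hμ, hμK⟩ := exists_outwardConormal hpq hL hx hxr hr hi
  have h1 := congrArg (quat p q) hμK
  rw [map_neg, quat_quat hpq, neg_neg, hθ x hx hxr μ hμ] at h1
  nth_rw 1 [← h1]
  simp [boundaryStructure_apply]

/-- The parametrization of the boundary circle by the angle. -/
noncomputable def circ (t : ℝ) : R2 := polar (1, t)

theorem circ_mem (t : ℝ) : circ t ∈ circle := by
  rw [circle, mem_sphere_zero_iff_norm, circ, norm_polar, abs_one]

theorem hasDerivAt_circ (t : ℝ) : HasDerivAt circ (rot (circ t)) t := by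
  have h := ((Real.hasDerivAt_cos t).smul_const e₁).add ((Real.hasDerivAt_sin t).smul_const e₂)
  convert! h using 1
  · ext y : 1
    simp [circ, polar]
  · simp [circ, polar, rot]

theorem hasDerivAt_boundary (h : ContDiffOn ℝ 2 ι disk) (t : ℝ) :
    HasDerivAt (fun t => ι (circ t)) (differential ι (circ t) (rot (circ t))) t := by
  have h1 := (hasFDerivWithinAt_differential h (circle_subset_disk (circ_mem t)))
  have h2 := h1.comp_hasDerivWithinAt (s := univ) t (hasDerivAt_circ t).hasDerivWithinAt
    (fun y _ => circle_subset_disk (circ_mem y))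
  exact h2.hasDerivAt Filter.univ_mem

theorem continuous_circ : Continuous circ :=
  contDiff_polar.continuous.comp (by fun_prop)

theorem dense_circ_regular (hb : IsBranchedImmersion ι) :
    Dense {t : ℝ | circ t ∈ regularPoints ι} := by
  have hfib : ∀ y : R2, {t : ℝ | circ t = y}.Countable := by
    intro y
    rcases eq_empty_or_nonempty {t : ℝ | circ t = y} with h0 | ⟨t₀, ht₀⟩
    · rw [h0]
      exact countable_empty
    · refine (countable_range fun n : ℤ => t₀ + 2 * Real.pi * n).mono fun t ht => ?_
      have h1 : circ t = circ t₀ := ht.trans ht₀.symm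
      have hc : Real.cos t = Real.cos t₀ := by
        simpa [circ, polar] using congrArg (fun z : R2 => z 0) h1
      have hs : Real.sin t = Real.sin t₀ := by
        simpa [circ, polar] using congrArg (fun z : R2 => z 1) h1
      obtain ⟨n, hn⟩ := Real.Angle.angle_eq_iff_two_pi_dvd_sub.1 (Real.Angle.cos_sin_inj hc hs)
      exact ⟨n, by simp only; linarith⟩
  have hc : {t : ℝ | circ t ∈ regularPoints ι}ᶜ.Countable := by
    refine (hb.finite_branch.countable.biUnion fun y _ => hfib y).mono fun t ht => ?_
    exact mem_biUnion (show circ t ∈ disk \ regularPoints ι from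
      ⟨circle_subset_disk (circ_mem t), ht⟩) rfl
  simpa using hc.dense_compl ℝ

theorem deriv_boundary_eq {p q θ : ℝ} (hb : IsBranchedImmersion ι) (hpq : p ^ 2 + q ^ 2 = 1)
    (hL : IsLagrangian ι) (hθ : HasConstantContactAngle ι θ)
    (hphase : ∀ x ∈ disk, jacRe ι x = density ι x * p ∧ jacIm ι x = density ι x * q) (t : ℝ) :
    differential ι (circ t) (rot (circ t)) =
      ‖differential ι (circ t) (rot (circ t))‖ • boundaryStructure p q θ (ι (circ t)) := by
  have hmem : ∀ t, circ t ∈ disk := fun t => circle_subset_disk (circ_mem t)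
  have hrot : Continuous fun t => rot (circ t) := by
    simp only [rot, circ, polar]
    fun_prop
  have hc1 : Continuous fun t => differential ι (circ t) (rot (circ t)) :=
    ((contDiffOn_differential hb.contDiffOn).continuousOn.comp_continuous continuous_circ
      hmem).clm_apply hrot
  have hc2 : Continuous fun t => ι (circ t) :=
    hb.contDiffOn.continuousOn.comp_continuous continuous_circ hmem
  refine congrFun (Continuous.ext_on (dense_circ_regular hb) hc1
    (hc1.norm.smul ((LinearMap.continuous_of_finiteDimensional _).comp hc2)) fun t ht => ?_) t
  exact differential_rot_eq hpq hL hθ (circ_mem t) ht (hphase _ (hmem t)).1 (hphase _ (hmem t)).2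

/-- A solution of `γ' = λ M γ` with `M² = -1` stays in the plane spanned by `γ 0` and `M γ 0`. -/
theorem inner_eq_zero_of_hasDerivAt {γ : ℝ → R4} {l : ℝ → ℝ} {M : R4 →ₗ[ℝ] R4}
    (hM : ∀ u, M (M u) = -u) (hγ : ∀ t, HasDerivAt γ (l t • M (γ t)) t) {n : R4}
    (h0 : ⟪n, γ 0⟫_ℝ = 0) (h1 : ⟪n, M (γ 0)⟫_ℝ = 0) (t : ℝ) : ⟪n, γ t⟫_ℝ = 0 := by
  have hd0 : ∀ t, HasDerivAt (fun t => ⟪n, γ t⟫_ℝ) (l t * ⟪n, M (γ t)⟫_ℝ) t := fun t => by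
    have := (hasDerivAt_const t n).inner ℝ (hγ t)
    simpa [inner_smul_right] using this
  have hd1 : ∀ t, HasDerivAt (fun t => ⟪n, M (γ t)⟫_ℝ) (-(l t * ⟪n, γ t⟫_ℝ)) t := fun t => by
    have hMγ : HasDerivAt (fun t => M (γ t)) (M (l t • M (γ t))) t :=
      M.toContinuousLinearMap.hasFDerivAt.comp_hasDerivAt t (hγ t)
    have := (hasDerivAt_const t n).inner ℝ hMγ
    simpa [inner_smul_right, hM] using this
  -- The sum of squares is conserved, since `M` acts as an infinitesimal rotation.
  have hE : ∀ t, HasDerivAt (fun t => ⟪n, γ t⟫_ℝ ^ 2 + ⟪n, M (γ t)⟫_ℝ ^ 2) 0 t := fun t => by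
    convert! ((hd0 t).pow 2).add ((hd1 t).pow 2) using 1
    simp
    ring
  have := is_const_of_deriv_eq_zero (fun t => (hE t).differentiableAt) (fun t => (hE t).deriv) t 0
  simp only [h0, h1] at this
  nlinarith [sq_nonneg ⟪n, γ t⟫_ℝ, sq_nonneg ⟪n, M (γ t)⟫_ℝ]

/-- The plane of the boundary curve, spanned by its starting point and its initial direction. -/
noncomputable def boundaryPlane (M : R4 →ₗ[ℝ] R4) (u : R4) : Submodule ℝ R4 :=
  Submodule.span ℝ {u, M u}

theorem finrank_boundaryPlane {M : R4 →ₗ[ℝ] R4} (hM : ∀ u, M (M u) = -u) {u : R4} (hu : u ≠ 0) :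
    Module.finrank ℝ (boundaryPlane M u) = 2 := by
  have hli : LinearIndependent ℝ ![u, M u] := by
    refine (LinearIndependent.pair_iff' hu).2 fun k hk => ?_
    have h1 := hM u
    rw [← hk, map_smul, ← hk, smul_smul] at h1
    have h2 : (k * k + 1) • u = 0 := by rw [add_smul, h1, one_smul, neg_add_cancel]
    rcases smul_eq_zero.1 h2 with h3 | h3
    · nlinarith [mul_self_nonneg k]
    · exact hu h3
  have := finrank_span_eq_card hli
  rwa [Matrix.range_cons_cons_empty, Fintype.card_fin] at this

theorem exists_circ {x : R2} (hx : x ∈ circle) : ∃ t, circ t = x := by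
  obtain ⟨t, -, ht⟩ := exists_polar x
  rw [mem_sphere_zero_iff_norm.1 hx] at ht
  exact ⟨t, ht⟩

theorem inner_boundary_eq_zero {p q θ : ℝ} (hb : IsBranchedImmersion ι)
    (hpq : p ^ 2 + q ^ 2 = 1) (hL : IsLagrangian ι) (hθ : HasConstantContactAngle ι θ)
    (hphase : ∀ x ∈ disk, jacRe ι x = density ι x * p ∧ jacIm ι x = density ι x * q) {n : R4}
    (hn : n ∈ (boundaryPlane (boundaryStructure p q θ) (ι (circ 0)))ᗮ) {x : R2}
    (hx : x ∈ circle) : ⟪n, ι x⟫_ℝ = 0 := by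
  obtain ⟨t, rfl⟩ := exists_circ hx
  rw [Submodule.mem_orthogonal'] at hn
  refine inner_eq_zero_of_hasDerivAt (boundaryStructure_sq hpq θ) (γ := fun t => ι (circ t))
    (l := fun t => ‖differential ι (circ t) (rot (circ t))‖) (fun t => ?_)
    (hn _ (Submodule.subset_span (by simp)))
    (hn _ (Submodule.subset_span (by simp))) t
  have h1 := hasDerivAt_boundary hb.contDiffOn t
  rw [deriv_boundary_eq hb hpq hL hθ hphase t] at h1
  exact h1

end Boundary

/-! ### The interior lies in the plane of the boundary -/

section Interior

variable {ι : R2 → R4}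

/-- A linear function that vanishes on the boundary of a surface of constant phase vanishes on the
surface. With `K = quat p q` the functions `u = ⟨n, ι⟩` and `v = ⟨K n, ι⟩` are conjugate harmonic,
`du ∧ dv = |du|² dA`, and Stokes' theorem gives `du = 0`. -/
theorem inner_eq_zero_of_boundary {p q : ℝ} (hb : IsBranchedImmersion ι) (hL : IsLagrangian ι)
    (hphase : ∀ x ∈ disk, jacRe ι x = density ι x * p ∧ jacIm ι x = density ι x * q) {n : R4}
    (hn : ∀ x ∈ circle, ⟪n, ι x⟫_ℝ = 0) {x : R2} (hx : x ∈ disk) : ⟪n, ι x⟫_ℝ = 0 := by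
  have hcd : ∀ m : R4, ContDiffOn ℝ 2 (fun x => ⟪m, ι x⟫_ℝ) disk := fun m =>
    (innerSL ℝ m).contDiff.comp_contDiffOn hb.contDiffOn
  have hfd : ∀ m : R4, ∀ y ∈ disk, fderivWithin ℝ (fun x => ⟪m, ι x⟫_ℝ) disk y =
      (innerSL ℝ m) ∘L differential ι y := fun m y hy =>
    ((innerSL ℝ m).hasFDerivAt.comp_hasFDerivWithinAt y
      (hasFDerivWithinAt_differential hb.contDiffOn hy)).fderivWithin (uniqueDiffOn_disk y hy)
  have hw : ∀ y ∈ disk,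
      density ι y * jacobian (fun x => ⟪n, ι x⟫_ℝ) (fun x => ⟪quat p q n, ι x⟫_ℝ) y =
        ⟪⟪n, differential ι y e₁⟫_ℝ • differential ι y e₂ -
            ⟪n, differential ι y e₂⟫_ℝ • differential ι y e₁,
          ⟪n, differential ι y e₁⟫_ℝ • differential ι y e₂ -
            ⟪n, differential ι y e₂⟫_ℝ • differential ι y e₁⟫_ℝ := by
    intro y hy
    rw [jacobian, hfd n y hy, hfd _ y hy]
    exact mul_wedge_eq (hL y hy _ _) (hphase y hy).1 (hphase y hy).2 n
  have hcj : ContinuousOn (jacobian (fun x => ⟪n, ι x⟫_ℝ) (fun x => ⟪quat p q n, ι x⟫_ℝ))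
      disk := by
    have hc := fun m (w : R2) => ((hcd m).continuousOn_fderivWithin uniqueDiffOn_disk
      (by norm_num)).clm_apply (continuousOn_const (c := w))
    exact ((hc _ _).mul (hc _ _)).sub ((hc _ _).mul (hc _ _))
  have hreg : ∀ y ∈ ball (0 : R2) 1 \ (disk \ regularPoints ι), y ∈ regularPoints ι :=
    fun y hy => by_contra fun h => hy.2 ⟨ball_subset_disk hy.1, h⟩
  -- At branch points the sign is recovered by continuity.
  have hpos : ∀ y ∈ disk,
      0 ≤ jacobian (fun x => ⟪n, ι x⟫_ℝ) (fun x => ⟪quat p q n, ι x⟫_ℝ) y := by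
    intro y hy
    have habs := eq_on_disk_of_eq_off_finite hcj.abs hcj hb.finite_branch (fun z hz => ?_) hy
    · rw [← habs]
      exact abs_nonneg _
    · have h1 := hw z (ball_subset_disk hz.1)
      have h2 := density_pos hL (hreg z hz)
      refine abs_of_nonneg (nonneg_of_mul_nonneg_right ?_ h2)
      rw [h1]
      exact real_inner_self_nonneg
  have hdu : ∀ y ∈ disk, fderivWithin ℝ (fun x => ⟪n, ι x⟫_ℝ) disk y = 0 := by
    intro y hy
    refine eq_on_disk_of_eq_off_finite (S := (disk \ regularPoints ι) ∪ {0})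
      ((hcd n).continuousOn_fderivWithin uniqueDiffOn_disk (by norm_num)) continuousOn_const
      (hb.finite_branch.union (finite_singleton 0)) (fun z hz => ?_) hy
    have hzd := ball_subset_disk hz.1
    have hzr : z ∈ regularPoints ι := hreg z ⟨hz.1, fun h => hz.2 (Or.inl h)⟩
    have h1 := hw z hzd
    rw [jacobian_eq_zero (hcd n) (hcd _) hn hpos hzd (fun h => hz.2 (Or.inr h)), mul_zero,
      eq_comm, inner_self_eq_zero, ← map_smul, ← map_smul, ← map_sub,
      map_eq_zero_iff _ hzr.2] at h1
    have h2 : ⟪n, differential ι z e₁⟫_ℝ = 0 := by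
      simpa using congrArg (fun w : R2 => w 1) h1
    have h3 : ⟪n, differential ι z e₂⟫_ℝ = 0 := by
      simpa using congrArg (fun w : R2 => w 0) h1
    rw [hfd n z hzd]
    ext w
    rw [eq_smul_add_smul w]
    simp [h2, h3, inner_add_right, inner_smul_right]
  have hconst := convex_disk.is_const_of_fderivWithin_eq_zero
    ((hcd n).differentiableOn (by norm_num)) hdu hx (circle_subset_disk (circ_mem 0))
  simpa [hn _ (circ_mem 0)] using hconst

end Interior

/-! ### Surjectivity onto the plane disk -/

/-- A map of the disk into a plane that has invertible differential off a finite set, maps the disk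
to the unit disk and the boundary to the unit circle, is onto the unit disk of the plane: off the
finitely many exceptional values its image is open and closed in the open unit disk. -/
theorem closedBall_subset_image {P : Type*} [NormedAddCommGroup P] [NormedSpace ℝ P]
    [FiniteDimensional ℝ P] (hP : Module.finrank ℝ P = 2) {g : R2 → P} {g' : R2 → R2 →L[ℝ] P}
    (hg : ContinuousOn g disk) {S : Set R2} (hS : S.Finite)
    (hd : ∀ x ∈ ball (0 : R2) 1 \ S, HasStrictFDerivAt g (g' x) x ∧ Function.Injective (g' x))
    (hdisk : MapsTo g disk (closedBall 0 1)) (hcirc : MapsTo g circle (sphere 0 1)) :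
    closedBall 0 1 ⊆ g '' disk := by
  have hnt : Nontrivial P := Module.nontrivial_of_finrank_pos (R := ℝ) (by omega)
  have hclosed : IsClosed (g '' disk) :=
    ((isCompact_closedBall 0 1).image_of_continuousOn hg).isClosed
  have hopen : ∀ x ∈ ball (0 : R2) 1 \ S, g '' disk ∈ nhds (g x) := by
    intro x hx
    have hsurj : Function.Surjective (g' x) :=
      (LinearMap.injective_iff_surjective_of_finrank_eq_finrank
        (f := (g' x).toLinearMap) (by rw [hP]; simp)).1 (hd x hx).2
    rw [← (hd x hx).1.map_nhds_eq_of_surj (LinearMap.range_eq_top.2 hsurj)]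
    exact Filter.image_mem_map (disk_mem_nhds hx.1)
  obtain ⟨x₀, hx₀⟩ : (ball (0 : R2) 1 \ S).Nonempty :=
    closure_nonempty_iff.1 ⟨0, disk_subset_closure_ball_diff hS
      (ball_subset_disk (mem_ball_self one_pos))⟩
  have hdense : Dense (g '' S)ᶜ := (hS.image g).countable.dense_compl ℝ
  have hint : interior (g '' disk) ⊆ ball 0 1 := by
    rw [← interior_closedBall (0 : P) one_ne_zero]
    exact interior_mono hdisk.image_subset
  have hsub : ball (0 : P) 1 \ g '' S ⊆ interior (g '' disk) := by
    refine (isPreconnected_ball_diff_countable (Module.lt_rank_of_lt_finrank (by rw [hP]; norm_num))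
      (hS.image g).countable).subset_left_of_subset_union isOpen_interior hclosed.isOpen_compl
      (disjoint_compl_right.mono_left interior_subset) ?_ ?_
    · intro y hy
      by_cases hyi : y ∈ g '' disk
      · left
        obtain ⟨x, hx, rfl⟩ := hyi
        refine mem_interior_iff_mem_nhds.2 (hopen x ⟨?_, fun hxS => hy.2 (mem_image_of_mem g hxS)⟩)
        have hx1 : ‖x‖ ≤ 1 := by simpa [disk] using hx
        rw [mem_ball_zero_iff]
        refine lt_of_le_of_ne hx1 fun h1 => ?_
        have h2 := hcirc (show x ∈ circle by simpa [circle] using h1)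
        rw [mem_sphere_zero_iff_norm] at h2
        exact absurd (mem_ball_zero_iff.1 hy.1) (by rw [h2]; exact lt_irrefl 1)
      · exact Or.inr hyi
    · obtain ⟨y, hy, hyS⟩ := hdense.inter_open_nonempty _ isOpen_interior
        ⟨g x₀, mem_interior_iff_mem_nhds.2 (hopen x₀ hx₀)⟩
      exact ⟨y, ⟨hint hy, hyS⟩, hy⟩
  calc closedBall (0 : P) 1 = closure (ball 0 1) := (closure_ball 0 one_ne_zero).symm
    _ ⊆ closure (ball 0 1 ∩ (g '' S)ᶜ) :=
        closure_minimal (hdense.open_subset_closure_inter isOpen_ball) isClosed_closure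
    _ ⊆ g '' disk := closure_minimal (hsub.trans interior_subset) hclosed

/-- A branched immersion of the disk into a plane with boundary on the unit sphere covers the unit
disk of that plane. -/
theorem image_eq_inter_closedBall {ι : R2 → R4} (hb : IsBranchedImmersion ι)
    (hball : MapsTo ι disk (closedBall 0 1)) (hbdry : MapsTo ι circle (sphere 0 1))
    {P : Submodule ℝ R4} (hP : Module.finrank ℝ P = 2) (hιP : ∀ x ∈ disk, ι x ∈ P) :
    ι '' disk = (P : Set R4) ∩ closedBall 0 1 := by
  refine Subset.antisymm (image_subset_iff.2 fun x hx => ⟨hιP x hx, hball hx⟩) ?_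
  have hproj : ∀ x ∈ disk, ((P.orthogonalProjectionOnto (ι x) : P) : R4) = ι x := fun x hx =>
    Submodule.starProjection_eq_self_iff.2 (hιP x hx)
  have hnorm : ∀ x ∈ disk, ‖P.orthogonalProjectionOnto (ι x)‖ = ‖ι x‖ := fun x hx => by
    change ‖((P.orthogonalProjectionOnto (ι x) : P) : R4)‖ = ‖ι x‖
    rw [hproj x hx]
  have htangent : ∀ x ∈ ball (0 : R2) 1, ∀ v, differential ι x v ∈ P := by
    intro x hx v
    have h1 := hasFDerivAt_differential hb.contDiffOn hx
    have h2 : HasFDerivAt ι (P.starProjection ∘L differential ι x) x :=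
      (P.starProjection.hasFDerivAt.comp x h1).congr_of_eventuallyEq
        (Filter.eventually_of_mem (disk_mem_nhds hx) fun y hy => (hproj y hy).symm)
    have h3 := congrArg (fun L : R2 →L[ℝ] R4 => L v) (h1.unique h2)
    exact Submodule.starProjection_eq_self_iff.1 h3.symm
  have hsub := closedBall_subset_image (P := P) hP (g := fun x => P.orthogonalProjectionOnto (ι x))
    (g' := fun x => P.orthogonalProjectionOnto ∘L differential ι x)
    (P.orthogonalProjectionOnto.continuous.comp_continuousOn hb.contDiffOn.continuousOn)
    hb.finite_branch (fun x hx => ⟨?_, ?_⟩)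
    (fun x hx => by
      rw [mem_closedBall_zero_iff, hnorm x hx]
      exact mem_closedBall_zero_iff.1 (hball hx))
    (fun x hx => by
      rw [mem_sphere_zero_iff_norm, hnorm x (circle_subset_disk hx)]
      exact mem_sphere_zero_iff_norm.1 (hbdry hx))
  · rintro y ⟨hyP, hy⟩
    obtain ⟨x, hx, hxy⟩ := hsub (show (⟨y, hyP⟩ : P) ∈ closedBall 0 1 by
      rw [mem_closedBall_zero_iff, Submodule.coe_norm]
      exact mem_closedBall_zero_iff.1 hy)
    exact ⟨x, hx, by rw [← hproj x hx]; exact congrArg Subtype.val hxy⟩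
  · have h1 : HasStrictFDerivAt ι (differential ι x) x := by
      have h2 := hasFDerivAt_differential hb.contDiffOn hx.1
      have h3 := (hb.contDiffOn.contDiffAt (disk_mem_nhds hx.1)).hasStrictFDerivAt (by norm_num)
      rwa [h2.fderiv] at h3
    exact P.orthogonalProjectionOnto.hasStrictFDerivAt.comp x h1
  · have hxr : x ∈ regularPoints ι := by_contra fun h => hx.2 ⟨ball_subset_disk hx.1, h⟩
    intro v w hvw
    refine hxr.2 ?_
    have h1 := congrArg Subtype.val hvw
    have h2 := fun v => Submodule.starProjection_eq_self_iff.2 (htangent x hx.1 v)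
    rw [← h2 v, ← h2 w]
    exact h1

theorem isEquatorialPlaneDisk_image {ι : R2 → R4} {θ : ℝ} (h_branched : IsBranchedImmersion ι)
    (h_ball : MapsTo ι disk (closedBall 0 1)) (h_bdry : MapsTo ι circle (sphere 0 1))
    (h_minimal : IsMinimal ι) (h_lagrangian : IsLagrangian ι)
    (hθ : HasConstantContactAngle ι θ) : IsEquatorialPlaneDisk (ι '' disk) := by
  obtain ⟨p, q, hpq, hphase⟩ := exists_phase h_branched h_lagrangian h_minimal
  have hne : ι (circ 0) ≠ 0 := fun h0 => by
    have := h_bdry (circ_mem 0)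
    rw [h0] at this
    simp at this
  have hP := finrank_boundaryPlane (boundaryStructure_sq hpq θ) hne
  refine ⟨_, hP, image_eq_inter_closedBall h_branched h_ball h_bdry hP fun x hx => ?_⟩
  rw [← Submodule.orthogonal_orthogonal
    (boundaryPlane (boundaryStructure p q θ) (ι (circ 0))), Submodule.mem_orthogonal]
  exact fun n hn => inner_eq_zero_of_boundary h_branched h_lagrangian hphase
    (fun y hy => inner_boundary_eq_zero h_branched hpq h_lagrangian hθ hphase hn hy) hx

end CapillaryLagrangian

theorem theorem1p1 (ι : CapillaryLagrangian.R2 → CapillaryLagrangian.R4)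
    (h_branched : CapillaryLagrangian.IsBranchedImmersion ι)
    (h_ball : Set.MapsTo ι CapillaryLagrangian.disk (Metric.closedBall 0 1))
    (h_bdry : Set.MapsTo ι CapillaryLagrangian.circle (Metric.sphere 0 1))
    (h_minimal : CapillaryLagrangian.IsMinimal ι)
    (h_lagrangian : CapillaryLagrangian.IsLagrangian ι)
    (h_legendrian : CapillaryLagrangian.HasLegendrianBoundary ι)
    (h_capillary : ∃ θ : ℝ, CapillaryLagrangian.HasConstantContactAngle ι θ) :
    CapillaryLagrangian.IsEquatorialPlaneDisk (ι '' CapillaryLagrangian.disk) := by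
  obtain ⟨θ, hθ⟩ := h_capillary
  exact CapillaryLagrangian.isEquatorialPlaneDisk_image h_branched h_ball h_bdry h_minimal
    h_lagrangian hθ
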